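/- Let $H$ be a real Hilbert space and let $A:H\rightrightarrows H$ be a maximal monotone operator, i.e. a set-valued map such that $\langle x^*-y^*,x-y\rangle\ge 0$ whenever $x^*\in Ax$, $y^*\in Ay$, and whose graph is not properly contained in the graph of another map with this property. Let $D(A)=\{z\in H: Az\neq\emptyset\}$ and $x\in D(A)$. For $\lambda\ge 0$ let $(I+\lambda A)^{-1}$ be the (a priori set-valued) operator with $z\in (I+\lambda A)^{-1}y$ if and only if $y=z+\lambda w$ for some $w\in Az$. Then: (i) for every integer $m\ge 1$ and every $t\ge 0$ the set $\left(I+\frac tm A\right)^{-m}x$ (the $m$-fold composition of $(I+\frac tm A)^{-1}$ applied to $x$) consists of exactly one point, denoted by $u_m(t)$; (ii) there is a function $u:[0,\infty)\to H$ such that $u_m\to u$ as $m\to\infty$, uniformly on every compact interval $[0,T]$; (iii) the set $Ax$ has exactly one element $A^0x$ of minimal norm, and $\|u(t)-u(s)\|\le\|A^0x\|\,|t-s|$ for all $s,t\ge 0$; (iv) $u$ is absolutely continuous on every compact interval $[0,T]$, $u(0)=x$, and for almost every $t>0$ the function $u$ is differentiable at $t$ with $\dot u(t)\in -Au(t)$.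 -/

import Mathlib

open Set Filter Topology MeasureTheory
open scoped Pointwise

namespace SetOperator

/-- The domain `D(A) = {u | A u ≠ ∅}` of a set-valued operator. -/
def dom {H : Type*} (A : H → Set H) : Set H := {u | (A u).Nonempty}

/-- The inverse of a set-valued operator: `z ∈ B⁻¹ y` iff `y ∈ B z`. -/
def inverse {H : Type*} (B : H → Set H) : H → Set H := fun y => {z | y ∈ B z}

/-- The powers of a set-valued operator under composition:
`B⁰ x = {x}` and `Bⁿ⁺¹ x` is the union of the sets `B y` over `y ∈ Bⁿ x`. -/
def power {H : Type*} (B : H → Set H) : ℕ → H → Set H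
  | 0 => fun x => {x}
  | n + 1 => fun x => ⋃ y ∈ power B n x, B y

/-- The resolvent `(I + l A)⁻¹`, as a set-valued operator; here
`(I + l A) z = {z + l w | w ∈ A z}`, which is empty when `A z` is empty. -/
def resolvent {H : Type*} [AddCommGroup H] [Module ℝ H] (A : H → Set H) (l : ℝ) : H → Set H :=
  inverse fun z => {z} + l • A z

/-- `⟨x' - y', x - y⟩ ≥ 0` for all `[x, x'], [y, y']` in the graph of `A`. -/
def IsMonotone {H : Type*} [NormedAddCommGroup H] [InnerProductSpace ℝ H]
    (A : H → Set H) : Prop :=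
  ∀ x y : H, ∀ x' ∈ A x, ∀ y' ∈ A y, 0 ≤ inner ℝ (x' - y') (x - y)

/-- A monotone operator whose graph is not properly contained in the graph of another monotone
operator (the order on `H → Set H` is pointwise inclusion, that is, inclusion of graphs). -/
def IsMaximalMonotone {H : Type*} [NormedAddCommGroup H] [InnerProductSpace ℝ H]
    (A : H → Set H) : Prop :=
  Maximal IsMonotone A

/-- The set of points of `A x` nearest to `0`. For `A` maximal monotone and `x ∈ D(A)` it has
exactly one element, the projection of `0` onto `A x`, which is the minimal section at `x`. -/
def minimalSection {H : Type*} [NormedAddCommGroup H] (A : H → Set H) (x : H) : Set H :=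
  {v ∈ A x | ∀ w ∈ A x, ‖v‖ ≤ ‖w‖}

/-- `u : [0, ∞) → H` (values at negative times are irrelevant) is a solution of the differential
inclusion `u' ∈ - A u` a.e. on `(0, ∞)`, `u 0 = x ∈ D(A)`: it is absolutely continuous on every
compact interval `[0, T]` and satisfies these conditions. -/
structure IsSolution {H : Type*} [NormedAddCommGroup H] [InnerProductSpace ℝ H]
    (A : H → Set H) (x : H) (u : ℝ → H) : Prop where
  absolutelyContinuous : ∀ T : ℝ, 0 ≤ T → AbsolutelyContinuousOnInterval u 0 T
  inclusion : ∀ᵐ t ∂(volume.restrict (Ioi (0 : ℝ))), ∃ v : H, HasDerivAt u v t ∧ v ∈ -A (u t)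
  initial : u 0 = x
  initial_mem : x ∈ dom A

end SetOperator

/-!
Existence for the Cauchy problem `u' ∈ -A u`, `u 0 = x`, with `A` maximal monotone on a Hilbert
space, by the exponential formula.

The resolvents `(I + l A)⁻¹`, `l > 0`, are everywhere defined by Minty's theorem
(`IsMaximalMonotone.resolvent_nonempty_of_pos`). By maximality a solution `z` of `y ∈ z + l A z` is
a common point of a family of closed balls, one for each point of the graph; by weak compactness
finitely many balls suffice, and there a maximization over the standard simplex produces the point
(`exists_forall_inner_nonneg_of_fintype`). Monotonicity makes resolvents single-valued and
nonexpansive, so that for `l ≥ 0` the implicit Euler scheme with step `l` defines one sequence from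
`x`. Two such sequences `X`, `Y` with steps `l`, `m` satisfy
`‖X i - Y j‖² ≤ ‖a‖² ((i l - j m)² + i l² + j m²)` for every `a ∈ A x`
(`IsEulerSequence.norm_sub_sq_le`). This gives the convergence of the exponential formula, uniform
on bounded intervals, and, with `a` the minimal section, the Lipschitz bound on the limit `u`.

For the inclusion, pair the scheme with a point `[y, w]` of the graph. In the limit
`‖u (t + s) - y‖² - ‖u t - y‖² ≤ -2 s ⟨w, u t - y⟩ + O(s²)` (`norm_sub_sq_sub_le_of_limit`), so at
a point of differentiability `⟨-u' t - w, u t - y⟩ ≥ 0` for all `[y, w]`, and maximality puts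
`-u' t` in `A (u t)`. Almost every `t` is such a point: a Lipschitz curve in a Hilbert space is
differentiable almost everywhere (`LipschitzWith.ae_differentiableAt_of_hilbert`), since in a
Hilbert basis of the separable closed span of its range its coordinates are, and by Bessel's
inequality their derivatives are the coordinates of a bounded measurable field of which the curve
is a primitive.
-/

/-! ### Almost everywhere differentiability of Lipschitz curves in a Hilbert space -/

/-- An orthonormal family in a separable space is countable: its members are at mutual distance
`√2`, so balls of radius `1 / 2` around them are disjoint. -/
theorem Orthonormal.countable {ι K : Type*} [NormedAddCommGroup K] [InnerProductSpace ℝ K]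
    [TopologicalSpace.SeparableSpace K] {b : ι → K} (hb : Orthonormal ℝ b) : Countable ι := by
  refine Pairwise.countable_of_isOpen_disjoint (s := fun i => Metric.ball (b i) (1 / 2)) ?_
    (fun i => Metric.isOpen_ball) fun i => ⟨b i, Metric.mem_ball_self (by norm_num)⟩
  intro i j hij
  refine Metric.ball_disjoint_ball ?_
  have h := norm_sub_sq_real (b i) (b j)
  rw [hb.1 i, hb.1 j, hb.2 hij] at h
  rw [dist_eq_norm]
  nlinarith [norm_nonneg (b i - b j)]

/-- If all the coordinates of a Lipschitz curve in a Hilbert basis are differentiable at `t`, their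
derivatives are the coordinates of a vector, by Bessel's inequality for the difference quotients. -/
theorem LipschitzWith.exists_inner_eq_deriv {ι K : Type*} [NormedAddCommGroup K]
    [InnerProductSpace ℝ K] (b : HilbertBasis ι ℝ K) {C : NNReal} {u : ℝ → K}
    (hu : LipschitzWith C u) {t : ℝ}
    (ht : ∀ i, DifferentiableAt ℝ (fun s => inner ℝ (b i) (u s)) t) :
    ∃ y : K, (∀ i, inner ℝ (b i) y = deriv (fun s => inner ℝ (b i) (u s)) t) ∧ ‖y‖ ≤ C := by
  set d : ι → ℝ := fun i => deriv (fun s => inner ℝ (b i) (u s)) t with hd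
  have bessel : ∀ F : Finset ι, ∑ i ∈ F, ‖d i‖ ^ 2 ≤ (C : ℝ) ^ 2 := by
    intro F
    have hlim : Tendsto (fun s => ∑ i ∈ F, ‖slope (fun s => inner ℝ (b i) (u s)) t s‖ ^ 2)
        (𝓝[≠] t) (𝓝 (∑ i ∈ F, ‖d i‖ ^ 2)) :=
      tendsto_finsetSum _ fun i _ =>
        ((hasDerivAt_iff_tendsto_slope.1 (ht i).hasDerivAt).norm.pow 2)
    refine le_of_tendsto hlim (eventually_nhdsWithin_of_forall fun s hs => ?_)
    have hslope : ∀ i, slope (fun s => inner ℝ (b i) (u s)) t s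
        = inner ℝ (b i) (slope u t s) := by
      intro i
      simp only [slope_def_module, inner_smul_right, inner_sub_right, smul_eq_mul]
    simp only [hslope]
    refine (b.orthonormal.sum_inner_products_le _).trans ?_
    have hst : 0 < |s - t| := abs_pos.2 (sub_ne_zero.2 hs)
    have hle : ‖slope u t s‖ ≤ C := by
      rw [slope_def_module, norm_smul, norm_inv, Real.norm_eq_abs, inv_mul_le_iff₀ hst,
        mul_comm, ← dist_eq_norm, ← Real.dist_eq]
      exact hu.dist_le_mul s t
    gcongr
  have bessel' : ∀ F : Finset ι,
      ∑ i ∈ F, ‖d i‖ ^ (2 : ENNReal).toReal ≤ (C : ℝ) ^ (2 : ENNReal).toReal := by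
    intro F
    simpa using bessel F
  refine ⟨b.repr.symm ⟨d, memℓp_gen' bessel'⟩, fun i => ?_, ?_⟩
  · rw [← b.repr_apply_apply, LinearIsometryEquiv.apply_symm_apply]
  · rw [LinearIsometryEquiv.norm_map]
    exact lp.norm_le_of_forall_sum_le (by simp) C.2 bessel'

/-- A Lipschitz curve in a separable Hilbert space is the primitive of the field whose coordinates
are the derivatives of its coordinates; Lebesgue's differentiation theorem applies. -/
theorem LipschitzWith.ae_differentiableAt_of_separable {K : Type*} [NormedAddCommGroup K]
    [InnerProductSpace ℝ K] [CompleteSpace K] [TopologicalSpace.SeparableSpace K]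
    {C : NNReal} {u : ℝ → K}
    (hu : LipschitzWith C u) : ∀ᵐ t : ℝ, DifferentiableAt ℝ u t := by
  obtain ⟨w, b, -⟩ := exists_hilbertBasis ℝ K
  have : Countable w := b.orthonormal.countable
  have hf : ∀ i, LipschitzWith C (fun s => inner ℝ (b i) (u s)) := by
    intro i
    refine LipschitzWith.of_dist_le_mul fun s t => ?_
    rw [Real.dist_eq, ← inner_sub_right]
    refine (abs_real_inner_le_norm _ _).trans ?_
    rw [b.orthonormal.1 i, one_mul, ← dist_eq_norm]
    exact hu.dist_le_mul s t
  have hdiff : ∀ᵐ t : ℝ, ∀ i, DifferentiableAt ℝ (fun s => inner ℝ (b i) (u s)) t :=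
    ae_all_iff.2 fun i => (hf i).ae_differentiableAt_real
  have hex : ∀ t : ℝ, ∃ y : K, ((∀ i, DifferentiableAt ℝ (fun s => inner ℝ (b i) (u s)) t) →
      ∀ i, inner ℝ (b i) y = deriv (fun s => inner ℝ (b i) (u s)) t) ∧ ‖y‖ ≤ C := by
    intro t
    by_cases ht : ∀ i, DifferentiableAt ℝ (fun s => inner ℝ (b i) (u s)) t
    · obtain ⟨y, hy, hyC⟩ := hu.exists_inner_eq_deriv b ht
      exact ⟨y, fun _ => hy, hyC⟩
    · exact ⟨0, fun h => absurd h ht, by simp⟩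
  choose g hg hgC using hex
  have hmeas : AEStronglyMeasurable g volume := by
    refine aestronglyMeasurable_of_tendsto_ae (atTop : Filter (Finset w))
      (f := fun F t => ∑ i ∈ F, deriv (fun s => inner ℝ (b i) (u s)) t • b i) (fun F => ?_) ?_
    · refine (Finset.stronglyMeasurable_fun_sum F fun i _ => ?_).aestronglyMeasurable
      exact (stronglyMeasurable_deriv _).smul_const _
    · filter_upwards [hdiff] with t ht
      have h := b.hasSum_repr (g t)
      simp only [b.repr_apply_apply, hg t ht] at h
      exact h
  have hloc : LocallyIntegrable g volume :=
    (locallyIntegrable_const (C : ℝ)).mono hmeas (Eventually.of_forall fun t => by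
      simpa using hgC t)
  have hprim : ∀ t, u t = u 0 + ∫ s in (0 : ℝ)..t, g s := by
    intro t
    refine b.repr.injective (lp.ext (funext fun i => ?_))
    rw [b.repr_apply_apply, b.repr_apply_apply, inner_add_right]
    have hcomm : ∫ s in (0 : ℝ)..t, inner ℝ (b i) (g s) = inner ℝ (b i) (∫ s in (0 : ℝ)..t, g s) :=
      (innerSL ℝ (b i)).intervalIntegral_comp_comm
        (hloc.integrableOn_isCompact isCompact_uIcc).intervalIntegrable
    have hae : ∫ s in (0 : ℝ)..t, inner ℝ (b i) (g s)
        = ∫ s in (0 : ℝ)..t, deriv (fun s => inner ℝ (b i) (u s)) s :=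
      intervalIntegral.integral_congr_ae (by
        filter_upwards [hdiff] with s hs _ using hg s hs i)
    have hftc := ((hf i).lipschitzOnWith
      (s := uIcc 0 t)).absolutelyContinuousOnInterval.integral_deriv_eq_sub
    rw [← hcomm, hae, hftc]
    ring
  filter_upwards [LocallyIntegrable.ae_hasDerivAt_integral hloc] with t ht
  rw [funext hprim]
  exact ((ht 0).const_add (u 0)).differentiableAt

/-- Lipschitz curves in a Hilbert space, separable or not, are differentiable almost everywhere:
the closed span of the range is separable. -/
theorem LipschitzWith.ae_differentiableAt_of_hilbert {H : Type*} [NormedAddCommGroup H]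
    [InnerProductSpace ℝ H] [CompleteSpace H] {C : NNReal} {u : ℝ → H}
    (hu : LipschitzWith C u) : ∀ᵐ t : ℝ, DifferentiableAt ℝ u t := by
  set K : Submodule ℝ H := (Submodule.span ℝ (range u)).topologicalClosure with hK
  have hsep : TopologicalSpace.IsSeparable (K : Set H) := by
    rw [hK, Submodule.topologicalClosure_coe]
    exact ((TopologicalSpace.isSeparable_range hu.continuous).span (R := ℝ)).closure
  have : TopologicalSpace.SeparableSpace K := hsep.separableSpace
  have : CompleteSpace K := (Submodule.isClosed_topologicalClosure _).completeSpace_coe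
  have hmem : ∀ t, u t ∈ K := fun t =>
    Submodule.le_topologicalClosure _ (Submodule.subset_span (mem_range_self t))
  have hv : LipschitzWith C (fun t => (⟨u t, hmem t⟩ : K)) := fun s t => hu s t
  filter_upwards [hv.ae_differentiableAt_of_separable] with t ht
  exact K.subtypeL.differentiableAt.comp (f := fun t => (⟨u t, hmem t⟩ : K)) t ht

/-! ### Resolvents of maximal monotone operators -/

/-- The finite case of Minty's theorem. With `c i = (u i - v i) / 2`, maximize the concave function
`p ↦ -∑ p i ⟨v i, u i⟩ - ‖∑ p i • c i‖²` over the standard simplex; at a maximizer `p` the point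
`z = ∑ p i • c i` is a solution: the first order conditions towards the vertices bound
`⟨v i + z, u i - z⟩` from below by minus the maximum, which monotonicity bounds from below by
`‖∑ p i • (u i + v i)‖² / 4`. -/
theorem exists_forall_inner_nonneg_of_fintype {ι H : Type*} [Fintype ι] [NormedAddCommGroup H]
    [InnerProductSpace ℝ H] (u v : ι → H) (h : ∀ i j, 0 ≤ inner ℝ (v i - v j) (u i - u j)) :
    ∃ z : H, ∀ i, 0 ≤ inner ℝ (v i + z) (u i - z) := by
  classical
  rcases isEmpty_or_nonempty ι with hι | hι
  · exact ⟨0, fun i => isEmptyElim i⟩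
  set c : ι → H := fun i => (1 / 2 : ℝ) • (u i - v i) with hc
  set F : (ι → ℝ) → ℝ := fun p => -(∑ i, p i * inner ℝ (v i) (u i)) - ‖∑ i, p i • c i‖ ^ 2 with hF
  have hFcont : Continuous F := by fun_prop
  obtain ⟨p, hp, hmax⟩ := (isCompact_stdSimplex ℝ ι).exists_isMaxOn
    ⟨_, single_mem_stdSimplex ℝ hι.some⟩ hFcont.continuousOn
  set S : ℝ := ∑ i, p i * inner ℝ (v i) (u i) with hS
  set z : H := ∑ i, p i • c i with hz
  set U : H := ∑ i, p i • u i with hU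
  set V : H := ∑ i, p i • v i with hV
  have hzUV : z = (1 / 2 : ℝ) • (U - V) := by
    simp only [hz, hc, hU, hV, ← Finset.sum_sub_distrib, Finset.smul_sum]
    exact Finset.sum_congr rfl fun i _ => by module
  -- Monotonicity, averaged over both indices with weights `p`.
  have hmono : inner ℝ V U ≤ S := by
    have h1 : ∀ j, 0 ≤ S - inner ℝ (v j) U - inner ℝ V (u j) + inner ℝ (v j) (u j) := by
      intro j
      have h2 : 0 ≤ ∑ i, p i * inner ℝ (v i - v j) (u i - u j) :=
        Finset.sum_nonneg fun i _ => mul_nonneg (hp.1 i) (h i j)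
      have h3 : ∑ i, p i * inner ℝ (v i - v j) (u i - u j)
          = S - inner ℝ (v j) U - inner ℝ V (u j) + (∑ i, p i) * inner ℝ (v j) (u j) := by
        simp only [hS, hU, hV, inner_sum, sum_inner, inner_smul_left, inner_smul_right,
          Finset.sum_mul, ← Finset.sum_sub_distrib, ← Finset.sum_add_distrib]
        refine Finset.sum_congr rfl fun i _ => ?_
        simp only [inner_sub_left, inner_sub_right, conj_trivial]
        ring
      rw [hp.2, one_mul] at h3
      linarith
    have h4 : 0 ≤ ∑ j, p j * (S - inner ℝ (v j) U - inner ℝ V (u j) + inner ℝ (v j) (u j)) :=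
      Finset.sum_nonneg fun j _ => mul_nonneg (hp.1 j) (h1 j)
    have h5 : ∑ j, p j * (S - inner ℝ (v j) U - inner ℝ V (u j) + inner ℝ (v j) (u j))
        = (∑ j, p j) * S - inner ℝ V U - inner ℝ V U + S := by
      have e1 : inner ℝ V U = ∑ j, p j * inner ℝ (v j) U := by
        simp only [hV, sum_inner, inner_smul_left, conj_trivial]
      have e2 : inner ℝ V U = ∑ j, p j * inner ℝ V (u j) := by
        simp only [hU, inner_sum, inner_smul_right]
      nth_rewrite 1 [e1]
      rw [e2]
      simp only [mul_add, mul_sub, Finset.sum_add_distrib, Finset.sum_sub_distrib, Finset.sum_mul]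
      rw [hS]
    rw [hp.2, one_mul] at h5
    linarith
  have hSz : 0 ≤ S + ‖z‖ ^ 2 := by
    have h1 : ‖z‖ ^ 2 = (1 / 4) * ‖U - V‖ ^ 2 := by
      rw [hzUV, norm_smul, mul_pow]
      norm_num
    have h2 := norm_sub_sq_real U V
    have h3 := norm_add_sq_real U V
    rw [real_inner_comm] at hmono
    nlinarith [sq_nonneg ‖U + V‖]
  refine ⟨z, fun i => ?_⟩
  have hdir : ∀ s ∈ Ioc (0 : ℝ) 1,
      -inner ℝ (v i) (u i) + S - 2 * inner ℝ z (c i - z) ≤ s * ‖c i - z‖ ^ 2 := by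
    intro s hs
    set q : ι → ℝ := (1 - s) • p + s • (Pi.single i 1 : ι → ℝ) with hq
    have hqmem : q ∈ stdSimplex ℝ ι :=
      convex_stdSimplex ℝ ι hp (single_mem_stdSimplex ℝ i) (by linarith [hs.2]) hs.1.le (by ring)
    have hle : F q ≤ F p := hmax hqmem
    have e1 : ∑ j, q j * inner ℝ (v j) (u j) = (1 - s) * S + s * inner ℝ (v i) (u i) := by
      simp only [hq, Pi.add_apply, Pi.smul_apply, smul_eq_mul, add_mul, Finset.sum_add_distrib,
        mul_assoc, ← Finset.mul_sum, Pi.single_apply, ite_mul, one_mul, zero_mul,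
        Finset.sum_ite_eq', Finset.mem_univ, if_true, hS]
    have e2 : ∑ j, q j • c j = z + s • (c i - z) := by
      have : ∑ j, q j • c j = (1 - s) • z + s • c i := by
        simp only [hq, Pi.add_apply, Pi.smul_apply, smul_eq_mul, add_smul, Finset.sum_add_distrib,
          mul_smul, ← Finset.smul_sum, Pi.single_apply, ite_smul, one_smul, zero_smul,
          Finset.sum_ite_eq', Finset.mem_univ, if_true, hz]
      rw [this]
      module
    have e3 : F q = -((1 - s) * S + s * inner ℝ (v i) (u i)) - ‖z + s • (c i - z)‖ ^ 2 := by
      simp only [hF, e1, e2]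
    have e4 : F p = -S - ‖z‖ ^ 2 := rfl
    rw [e3, e4, norm_add_sq_real, inner_smul_right, norm_smul, Real.norm_of_nonneg hs.1.le,
      mul_pow] at hle
    refine le_of_mul_le_mul_left ?_ hs.1
    nlinarith
  have hvertex : -inner ℝ (v i) (u i) + S - 2 * inner ℝ z (c i - z) ≤ 0 := by
    have hlim : Tendsto (fun s : ℝ => s * ‖c i - z‖ ^ 2) (𝓝[>] 0) (𝓝 0) :=
      tendsto_nhdsWithin_of_tendsto_nhds
        (Continuous.tendsto' (by fun_prop) _ _ (zero_mul _))
    exact ge_of_tendsto hlim (by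
      filter_upwards [Ioc_mem_nhdsGT (zero_lt_one' ℝ)] with s hs using hdir s hs)
  have hci : inner ℝ z (c i) = (1 / 2) * (inner ℝ z (u i) - inner ℝ (v i) z) := by
    rw [hc, inner_smul_right, inner_sub_right, real_inner_comm (v i) z]
  rw [inner_sub_right, real_inner_self_eq_norm_sq, hci] at hvertex
  rw [inner_add_left, inner_sub_right, inner_sub_right, real_inner_self_eq_norm_sq]
  linarith

/-- The points `z` with `0 ≤ ⟨v + z, u - z⟩` form the closed ball with diameter `[-v, u]`. -/
theorem inner_add_sub_nonneg_iff_mem_closedBall {H : Type*} [NormedAddCommGroup H]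
    [InnerProductSpace ℝ H] (u v z : H) :
    0 ≤ inner ℝ (v + z) (u - z) ↔
      z ∈ Metric.closedBall ((1 / 2 : ℝ) • (u - v)) ((1 / 2) * ‖u + v‖) := by
  have h1 : ‖z - (1 / 2 : ℝ) • (u - v)‖ ^ 2
      = ((1 / 2) * ‖u + v‖) ^ 2 - inner ℝ (v + z) (u - z) := by
    rw [norm_sub_sq_real, norm_smul, mul_pow, mul_pow, norm_sub_sq_real, norm_add_sq_real,
      inner_smul_right, inner_add_left, inner_sub_right, inner_sub_right, inner_sub_right,
      real_inner_self_eq_norm_sq, real_inner_comm v u, real_inner_comm v z]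
    norm_num
    ring
  rw [Metric.mem_closedBall, dist_eq_norm, ← sq_le_sq₀ (norm_nonneg _) (by positivity), h1]
  constructor <;> intro h <;> linarith

/-- The finite case extends to arbitrary monotone sets since closed balls are weakly compact. -/
theorem exists_forall_inner_nonneg {H : Type*} [NormedAddCommGroup H] [InnerProductSpace ℝ H]
    [CompleteSpace H] (G : Set (H × H))
    (hG : ∀ p ∈ G, ∀ q ∈ G, 0 ≤ inner ℝ (p.2 - q.2) (p.1 - q.1)) :
    ∃ z : H, ∀ p ∈ G, 0 ≤ inner ℝ (p.2 + z) (p.1 - z) := by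
  classical
  rcases G.eq_empty_or_nonempty with rfl | ⟨p₀, hp₀⟩
  · exact ⟨0, by simp⟩
  obtain ⟨B, hBcomp, hBclosed, hB⟩ : ∃ B : H × H → Set (WeakDual ℝ H),
      (∀ p, IsCompact (B p)) ∧ (∀ p, IsClosed (B p)) ∧ ∀ p f, f ∈ B p ↔
        0 ≤ inner ℝ (p.2 + (InnerProductSpace.toDual ℝ H).symm (WeakDual.toStrongDual f))
          (p.1 - (InnerProductSpace.toDual ℝ H).symm (WeakDual.toStrongDual f)) := by
    refine ⟨fun p => WeakDual.toStrongDual ⁻¹' Metric.closedBall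
      (InnerProductSpace.toDual ℝ H ((1 / 2 : ℝ) • (p.1 - p.2))) ((1 / 2) * ‖p.1 + p.2‖),
      fun p => WeakDual.isCompact_closedBall _ _, fun p => WeakDual.isClosed_closedBall _ _,
      fun p f => ?_⟩
    rw [inner_add_sub_nonneg_iff_mem_closedBall, Metric.mem_closedBall,
      ← (InnerProductSpace.toDual ℝ H).dist_map, LinearIsometryEquiv.apply_symm_apply]
    rfl
  have hfin : ∀ s : Finset G, (B p₀ ∩ ⋂ p ∈ s, B (p : H × H)).Nonempty := by
    intro s
    obtain ⟨z, hz⟩ := exists_forall_inner_nonneg_of_fintype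
      (ι := ↥(insert (⟨p₀, hp₀⟩ : G) s))
      (fun i => (i : G).1.1) (fun i => (i : G).1.2) (fun i j => hG _ i.1.2 _ j.1.2)
    have hmem : ∀ p : G, p ∈ insert (⟨p₀, hp₀⟩ : G) s →
        StrongDual.toWeakDual (InnerProductSpace.toDual ℝ H z) ∈ B p := by
      intro p hp
      rw [hB]
      simpa using hz ⟨p, hp⟩
    exact ⟨_, hmem ⟨p₀, hp₀⟩ (Finset.mem_insert_self _ _),
      mem_iInter₂.2 fun p hp => hmem p (Finset.mem_insert_of_mem hp)⟩
  obtain ⟨f, -, hf⟩ := (hBcomp p₀).inter_iInter_nonempty (fun p : G => B p)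
    (fun p => hBclosed p) hfin
  exact ⟨_, fun p hp => (hB p f).1 (mem_iInter.1 hf ⟨p, hp⟩)⟩

namespace SetOperator

/-- Maximality in the form in which it is used: a pair monotonically related to the graph of `A`
belongs to it. -/
theorem IsMaximalMonotone.mem_of_forall_inner_nonneg {H : Type*} [NormedAddCommGroup H]
    [InnerProductSpace ℝ H] {A : H → Set H} (hA : IsMaximalMonotone A) {x v : H}
    (h : ∀ y, ∀ w ∈ A y, 0 ≤ inner ℝ (v - w) (x - y)) : v ∈ A x := by
  have hB : IsMonotone fun z => A z ∪ {v' | z = x ∧ v' = v} := by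
    rintro y z y' (hy | ⟨rfl, rfl⟩) z' (hz | ⟨rfl, rfl⟩)
    · exact hA.1 y z y' hy z' hz
    · rw [← neg_sub, ← neg_sub z y, inner_neg_neg]
      exact h y y' hy
    · exact h z z' hz
    · simp
  exact hA.2 hB (fun z => subset_union_left) x (Or.inr ⟨rfl, rfl⟩)

theorem mem_resolvent_iff {H : Type*} [AddCommGroup H] [Module ℝ H] {A : H → Set H} {l : ℝ}
    {y z : H} : z ∈ resolvent A l y ↔ ∃ w ∈ A z, y = z + l • w := by
  simp only [resolvent, inverse, mem_ofPred_eq, singleton_add, mem_image, mem_smul_set]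
  constructor
  · rintro ⟨-, ⟨w, hw, rfl⟩, rfl⟩
    exact ⟨w, hw, rfl⟩
  · rintro ⟨w, hw, rfl⟩
    exact ⟨_, ⟨w, hw, rfl⟩, rfl⟩

theorem mem_dom_of_mem_resolvent {H : Type*} [AddCommGroup H] [Module ℝ H] {A : H → Set H} {l : ℝ}
    {y z : H} (h : z ∈ resolvent A l y) : z ∈ dom A := by
  obtain ⟨w, hw, -⟩ := mem_resolvent_iff.1 h
  exact ⟨w, hw⟩

/-- Minty's theorem: `I + l A` is surjective for `l > 0`. -/
theorem IsMaximalMonotone.resolvent_nonempty_of_pos {H : Type*} [NormedAddCommGroup H]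
    [InnerProductSpace ℝ H] [CompleteSpace H] {A : H → Set H} (hA : IsMaximalMonotone A) {l : ℝ}
    (hl : 0 < l) (y : H) : (resolvent A l y).Nonempty := by
  -- The graph of `l A - y`, whose value at the solution `z` contains `-z`.
  obtain ⟨z, hz⟩ := exists_forall_inner_nonneg {p : H × H | ∃ v ∈ A p.1, p.2 = l • v - y} (by
    rintro ⟨u, -⟩ ⟨v, hv, rfl⟩ ⟨u', -⟩ ⟨v', hv', rfl⟩
    have h := hA.1 u u' v hv v' hv'
    simp only [sub_sub_sub_cancel_right, ← smul_sub, inner_smul_left, conj_trivial]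
    positivity)
  refine ⟨z, mem_resolvent_iff.2
    ⟨l⁻¹ • (y - z), hA.mem_of_forall_inner_nonneg fun u v hv => ?_, ?_⟩⟩
  · have h := hz (u, l • v - y) ⟨v, hv, rfl⟩
    have e : l⁻¹ • (y - z) - v = -(l⁻¹ • (l • v - y + z)) := by
      have : l⁻¹ • l • v = v := inv_smul_smul₀ hl.ne' v
      rw [smul_add, smul_sub, smul_sub, this]
      abel
    rw [e, ← neg_sub u z, inner_neg_neg, inner_smul_left, conj_trivial]
    positivity
  · rw [smul_smul, mul_inv_cancel₀ hl.ne', one_smul]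
    abel

/-- The assumption on `y` serves the case `l = 0`: the resolvent of order `0` is the identity on
`D(A)`, and empty elsewhere. -/
theorem IsMaximalMonotone.resolvent_nonempty {H : Type*} [NormedAddCommGroup H]
    [InnerProductSpace ℝ H] [CompleteSpace H] {A : H → Set H} (hA : IsMaximalMonotone A) {l : ℝ}
    (hl : 0 ≤ l) {y : H} (hy : y ∈ dom A) : (resolvent A l y).Nonempty := by
  rcases hl.eq_or_lt with rfl | hl
  · obtain ⟨w, hw⟩ := hy
    exact ⟨y, mem_resolvent_iff.2 ⟨w, hw, by simp⟩⟩
  · exact hA.resolvent_nonempty_of_pos hl y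

theorem IsMonotone.norm_sub_le_of_mem_resolvent {H : Type*} [NormedAddCommGroup H]
    [InnerProductSpace ℝ H] {A : H → Set H} (hA : IsMonotone A) {l : ℝ} (hl : 0 ≤ l)
    {y y' z z' : H} (hz : z ∈ resolvent A l y) (hz' : z' ∈ resolvent A l y') :
    ‖z - z'‖ ≤ ‖y - y'‖ := by
  obtain ⟨w, hw, rfl⟩ := mem_resolvent_iff.1 hz
  obtain ⟨w', hw', rfl⟩ := mem_resolvent_iff.1 hz'
  have h := mul_nonneg hl (hA z z' w hw w' hw')
  have e : z + l • w - (z' + l • w') = (z - z') + l • (w - w') := by module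
  rw [e, ← sq_le_sq₀ (norm_nonneg _) (norm_nonneg _), norm_add_sq_real, inner_smul_right,
    real_inner_comm]
  nlinarith [sq_nonneg ‖l • (w - w')‖]

theorem IsMonotone.resolvent_subsingleton {H : Type*} [NormedAddCommGroup H]
    [InnerProductSpace ℝ H] {A : H → Set H} (hA : IsMonotone A) {l : ℝ} (hl : 0 ≤ l) (y : H) :
    (resolvent A l y).Subsingleton := by
  intro z hz z' hz'
  have h := hA.norm_sub_le_of_mem_resolvent hl hz hz'
  rw [sub_self, norm_zero] at h
  exact sub_eq_zero.1 (norm_le_zero_iff.1 h)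

theorem IsMonotone.norm_resolvent_sub_le {H : Type*} [NormedAddCommGroup H]
    [InnerProductSpace ℝ H] {A : H → Set H} (hA : IsMonotone A) {l : ℝ} (hl : 0 ≤ l)
    {y z a : H} (hz : z ∈ resolvent A l y) (ha : a ∈ A y) : ‖z - y‖ ≤ l * ‖a‖ := by
  obtain ⟨w, hw, hy⟩ := mem_resolvent_iff.1 hz
  have h := mul_nonneg hl (hA y z a ha w hw)
  have e : y - z = l • w := by rw [hy]; abel
  have h1 : ‖y - z‖ ^ 2 = l * inner ℝ w (y - z) := by
    rw [← real_inner_self_eq_norm_sq]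
    nth_rewrite 1 [e]
    rw [inner_smul_left, conj_trivial]
  have h2 : ‖y - z‖ ^ 2 ≤ l * ‖a‖ * ‖y - z‖ := by
    rw [inner_sub_left] at h
    have := mul_le_mul_of_nonneg_left (real_inner_le_norm a (y - z)) hl
    linarith
  rw [norm_sub_rev]
  rcases (norm_nonneg (y - z)).eq_or_lt with h0 | h0
  · rw [← h0]
    positivity
  · rw [sq] at h2
    exact le_of_mul_le_mul_right h2 h0

/-- Resolvents of different orders, compared through their previous points: the recursion behind
the estimate of `IsEulerSequence.norm_sub_sq_le`. -/
theorem IsMonotone.add_mul_norm_sub_sq_le {H : Type*} [NormedAddCommGroup H]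
    [InnerProductSpace ℝ H] {A : H → Set H} (hA : IsMonotone A) {l m : ℝ} (hl : 0 ≤ l) (hm : 0 ≤ m)
    {y y' z z' : H} (hz : z ∈ resolvent A l y) (hz' : z' ∈ resolvent A m y') :
    (l + m) * ‖z - z'‖ ^ 2 ≤ m * ‖y - z'‖ ^ 2 + l * ‖z - y'‖ ^ 2 := by
  obtain ⟨w, hw, rfl⟩ := mem_resolvent_iff.1 hz
  obtain ⟨w', hw', rfl⟩ := mem_resolvent_iff.1 hz'
  have h := mul_nonneg (mul_nonneg hl hm) (hA z z' w hw w' hw')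
  have e : z + l • w - z' = (z - z') + l • w := by abel
  have e' : z - (z' + m • w') = (z - z') - m • w' := by abel
  rw [e, e', norm_add_sq_real, norm_sub_sq_real (z - z'), inner_smul_right, inner_smul_right]
  rw [inner_sub_left, real_inner_comm, real_inner_comm (z - z') w'] at h
  nlinarith [mul_nonneg hm (sq_nonneg ‖l • w‖), mul_nonneg hl (sq_nonneg ‖m • w'‖)]

/-! ### The minimal section -/

/-- A value of a maximal monotone operator is an intersection of closed half-spaces. -/
theorem IsMaximalMonotone.eq_iInter {H : Type*} [NormedAddCommGroup H] [InnerProductSpace ℝ H]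
    {A : H → Set H} (hA : IsMaximalMonotone A) (x : H) :
    A x = ⋂ (y : H) (w ∈ A y), {v | inner ℝ w (x - y) ≤ inner ℝ v (x - y)} := by
  ext v
  simp only [mem_iInter, mem_ofPred_eq]
  refine ⟨fun hv y w hw => ?_, fun h => hA.mem_of_forall_inner_nonneg fun y w hw => ?_⟩
  · have := hA.1 x y v hv w hw
    rw [inner_sub_left] at this
    linarith
  · rw [inner_sub_left]
    linarith [h y w hw]

theorem IsMaximalMonotone.isClosed {H : Type*} [NormedAddCommGroup H] [InnerProductSpace ℝ H]
    {A : H → Set H} (hA : IsMaximalMonotone A) (x : H) : IsClosed (A x) := by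
  rw [hA.eq_iInter x]
  exact isClosed_iInter fun y => isClosed_iInter fun w => isClosed_iInter fun _ =>
    isClosed_le continuous_const (by fun_prop)

theorem IsMaximalMonotone.convex {H : Type*} [NormedAddCommGroup H] [InnerProductSpace ℝ H]
    {A : H → Set H} (hA : IsMaximalMonotone A) (x : H) : Convex ℝ (A x) := by
  rw [hA.eq_iInter x]
  refine convex_iInter fun y => convex_iInter fun w => convex_iInter fun _ => ?_
  exact convex_halfSpace_ge ⟨fun v v' => inner_add_left v v' _, fun c v => by
    rw [inner_smul_left, conj_trivial, smul_eq_mul]⟩ _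

theorem IsMaximalMonotone.exists_minimalSection_eq_singleton {H : Type*} [NormedAddCommGroup H]
    [InnerProductSpace ℝ H] [CompleteSpace H] {A : H → Set H} (hA : IsMaximalMonotone A) {x : H}
    (hx : x ∈ dom A) : ∃ a, minimalSection A x = {a} := by
  obtain ⟨a, ha, hmin⟩ :=
    exists_norm_eq_iInf_of_complete_convex hx (hA.isClosed x).isComplete (hA.convex x) 0
  have hinner := (norm_eq_iInf_iff_real_inner_le_zero (hA.convex x) ha).1 hmin
  -- The variational inequality gives minimality and uniqueness at once.
  have hpyth : ∀ w ∈ A x, ‖a‖ ^ 2 + ‖w - a‖ ^ 2 ≤ ‖w‖ ^ 2 := by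
    intro w hw
    have h := hinner w hw
    have e := norm_add_sq_real a (w - a)
    rw [zero_sub, inner_neg_left] at h
    rw [add_sub_cancel] at e
    linarith
  refine ⟨a, Subset.antisymm (fun v hv => ?_) (singleton_subset_iff.2 ⟨ha, fun w hw => ?_⟩)⟩
  · have h1 := hpyth v hv.1
    have h2 := pow_le_pow_left₀ (norm_nonneg v) (hv.2 a ha) 2
    have h3 : ‖v - a‖ ^ 2 = 0 := le_antisymm (by linarith) (sq_nonneg _)
    exact sub_eq_zero.1 (norm_eq_zero.1 (pow_eq_zero_iff two_ne_zero |>.1 h3))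
  · refine (sq_le_sq₀ (norm_nonneg _) (norm_nonneg _)).1 ?_
    linarith [hpyth w hw, sq_nonneg ‖w - a‖]

/-! ### Implicit Euler sequences -/

/-- The sequences obtained from the implicit Euler scheme with step `l`:
each term lies in the resolvent of order `l` of the preceding one. -/
def IsEulerSequence {H : Type*} [AddCommGroup H] [Module ℝ H] (A : H → Set H) (l : ℝ)
    (X : ℕ → H) : Prop :=
  ∀ i, X (i + 1) ∈ resolvent A l (X i)

theorem IsMaximalMonotone.exists_isEulerSequence {H : Type*} [NormedAddCommGroup H]
    [InnerProductSpace ℝ H] [CompleteSpace H] {A : H → Set H} (hA : IsMaximalMonotone A) {l : ℝ}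
    (hl : 0 ≤ l) {x : H} (hx : x ∈ dom A) : ∃ X : ℕ → H, X 0 = x ∧ IsEulerSequence A l X := by
  have h : ∀ y : dom A, ∃ z : dom A, (z : H) ∈ resolvent A l y := fun y =>
    let ⟨z, hz⟩ := hA.resolvent_nonempty hl y.2
    ⟨⟨z, mem_dom_of_mem_resolvent hz⟩, hz⟩
  choose J hJ using h
  refine ⟨fun n => (J^[n] ⟨x, hx⟩ : dom A), rfl, fun i => ?_⟩
  simp only [Function.iterate_succ_apply']
  exact hJ _

theorem IsEulerSequence.power_resolvent_eq {H : Type*} [NormedAddCommGroup H]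
    [InnerProductSpace ℝ H] {A : H → Set H} {l : ℝ} {X : ℕ → H} (hX : IsEulerSequence A l X)
    (hA : IsMonotone A) (hl : 0 ≤ l) (n : ℕ) : power (resolvent A l) n (X 0) = {X n} := by
  induction n with
  | zero => rfl
  | succ n ih =>
    simp only [power, ih, mem_singleton_iff, iUnion_iUnion_eq_left]
    exact Subset.antisymm (fun z hz => hA.resolvent_subsingleton hl _ hz (hX n))
      (singleton_subset_iff.2 (hX n))

theorem IsEulerSequence.norm_succ_sub_le {H : Type*} [NormedAddCommGroup H]
    [InnerProductSpace ℝ H] {A : H → Set H} {l : ℝ} {X : ℕ → H} (hX : IsEulerSequence A l X)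
    (hA : IsMonotone A) (hl : 0 ≤ l) {a : H} (ha : a ∈ A (X 0)) (n : ℕ) :
    ‖X (n + 1) - X n‖ ≤ l * ‖a‖ := by
  induction n with
  | zero => exact hA.norm_resolvent_sub_le hl (hX 0) ha
  | succ n ih => exact (hA.norm_sub_le_of_mem_resolvent hl (hX (n + 1)) (hX n)).trans ih

theorem IsEulerSequence.norm_add_sub_le {H : Type*} [NormedAddCommGroup H]
    [InnerProductSpace ℝ H] {A : H → Set H} {l : ℝ} {X : ℕ → H} (hX : IsEulerSequence A l X)
    (hA : IsMonotone A) (hl : 0 ≤ l) {a : H} (ha : a ∈ A (X 0)) (j k : ℕ) :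
    ‖X (j + k) - X j‖ ≤ k * l * ‖a‖ := by
  induction k with
  | zero => simp
  | succ k ih =>
    have h := hX.norm_succ_sub_le hA hl ha (j + k)
    have e : X (j + (k + 1)) - X j = (X (j + k + 1) - X (j + k)) + (X (j + k) - X j) := by
      rw [← add_assoc]
      abel
    rw [e]
    push_cast
    linarith [norm_add_le (X (j + k + 1) - X (j + k)) (X (j + k) - X j)]

/-- The Crandall–Liggett estimate in Kobayashi's form, for Euler sequences with different steps.
The right-hand side satisfies the recursion of `IsMonotone.add_mul_norm_sub_sq_le` with equality. -/
theorem IsEulerSequence.norm_sub_sq_le {H : Type*} [NormedAddCommGroup H]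
    [InnerProductSpace ℝ H] {A : H → Set H} {l m : ℝ} {X Y : ℕ → H} (hX : IsEulerSequence A l X)
    (hY : IsEulerSequence A m Y) (hA : IsMonotone A) (hl : 0 ≤ l) (hm : 0 ≤ m) (h0 : X 0 = Y 0)
    {a : H} (ha : a ∈ A (X 0)) (i j : ℕ) :
    ‖X i - Y j‖ ^ 2 ≤ ‖a‖ ^ 2 * ((i * l - j * m) ^ 2 + i * l ^ 2 + j * m ^ 2) := by
  have hX0 : ∀ i, ‖X i - X 0‖ ≤ i * l * ‖a‖ := fun i => by
    simpa using hX.norm_add_sub_le hA hl ha 0 i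
  have hY0 : ∀ j, ‖Y j - Y 0‖ ≤ j * m * ‖a‖ := fun j => by
    simpa using hY.norm_add_sub_le hA hm (h0 ▸ ha) 0 j
  rcases (add_nonneg hl hm).eq_or_lt with hlm | hlm
  · obtain rfl : l = 0 := by linarith
    obtain rfl : m = 0 := by linarith
    have h1 : X i = X 0 := by simpa [sub_eq_zero] using hX0 i
    have h2 : Y j = Y 0 := by simpa [sub_eq_zero] using hY0 j
    rw [h1, h2, h0]
    simp
  induction i generalizing j with
  | zero =>
    have h1 : ‖X 0 - Y j‖ ^ 2 ≤ (j * m * ‖a‖) ^ 2 := by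
      rw [h0, norm_sub_rev]
      exact pow_le_pow_left₀ (norm_nonneg _) (hY0 j) 2
    have h2 : 0 ≤ ‖a‖ ^ 2 * (j * m ^ 2) := by positivity
    push_cast
    linarith
  | succ i ihi =>
    induction j with
    | zero =>
      have h1 : ‖X (i + 1) - Y 0‖ ^ 2 ≤ ((i + 1 : ℕ) * l * ‖a‖) ^ 2 := by
        rw [← h0]
        exact pow_le_pow_left₀ (norm_nonneg _) (hX0 _) 2
      have h2 : 0 ≤ ‖a‖ ^ 2 * ((i + 1 : ℕ) * l ^ 2) := by positivity
      push_cast at h1 h2 ⊢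
      linarith
    | succ j ihj =>
      have h1 := hA.add_mul_norm_sub_sq_le hl hm (hX i) (hY j)
      have h2 := mul_le_mul_of_nonneg_left (ihi (j + 1)) hm
      have h3 := mul_le_mul_of_nonneg_left ihj hl
      refine le_of_mul_le_mul_left ?_ hlm
      push_cast at h2 h3 ⊢
      linarith

/-- The discrete form of the inequality that characterizes the limit as an integral solution:
pairing with `[y, w]` in the graph, and replacing the points `X (j + 1), …, X (j + k)`
by `X j` at a cost quadratic in the elapsed time `k * l`. -/
theorem IsEulerSequence.norm_sub_sq_sub_le {H : Type*} [NormedAddCommGroup H]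
    [InnerProductSpace ℝ H] {A : H → Set H} {l : ℝ} {X : ℕ → H} (hX : IsEulerSequence A l X)
    (hA : IsMonotone A) (hl : 0 ≤ l) {a : H} (ha : a ∈ A (X 0)) {y w : H} (hw : w ∈ A y)
    (j k : ℕ) :
    ‖X (j + k) - y‖ ^ 2 - ‖X j - y‖ ^ 2
      ≤ -(2 * (k * l) * inner ℝ w (X j - y)) + 2 * ‖w‖ * ‖a‖ * (k * l) ^ 2 := by
  induction k with
  | zero => simp
  | succ k ih =>
    obtain ⟨v, hv, hXv⟩ := mem_resolvent_iff.1 (hX (j + k))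
    have h1 := mul_nonneg hl (hA _ y v hv w hw)
    have e : X (j + k) - y = (X (j + k + 1) - y) + l • v := by
      rw [hXv]
      abel
    have h2 : ‖X (j + k) - y‖ ^ 2
        = ‖X (j + k + 1) - y‖ ^ 2 + 2 * (l * inner ℝ v (X (j + k + 1) - y)) + ‖l • v‖ ^ 2 := by
      rw [e, norm_add_sq_real, inner_smul_right, real_inner_comm]
    have h3 : inner ℝ w (X (j + k + 1) - y)
        = inner ℝ w (X j - y) + inner ℝ w (X (j + k + 1) - X j) := by
      rw [← inner_add_right]
      congr 1
      abel
    have h4 : -(‖w‖ * ((k + 1) * l * ‖a‖)) ≤ inner ℝ w (X (j + k + 1) - X j) := by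
      have h5 := hX.norm_add_sub_le hA hl ha j (k + 1)
      push_cast at h5
      have h6 := (abs_real_inner_le_norm w (X (j + k + 1) - X j)).trans
        (mul_le_mul_of_nonneg_left h5 (norm_nonneg w))
      exact (abs_le.1 h6).1
    have h7 := mul_le_mul_of_nonneg_left h4 hl
    rw [inner_sub_left, h3] at h1
    have h8 : 0 ≤ 2 * ‖w‖ * ‖a‖ * (k * l ^ 2) := by positivity
    rw [← add_assoc]
    push_cast
    nlinarith [sq_nonneg ‖l • v‖]

end SetOperator

/-! ### The limit curve and its derivative -/

namespace SetOperator

/-- The common limit of Euler sequences whose steps tend to `0`, with the error bound obtained by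
letting one of the two steps tend to `0` in `IsEulerSequence.norm_sub_sq_le`. -/
theorem exists_limit_of_isEulerSequence {H : Type*} [NormedAddCommGroup H]
    [InnerProductSpace ℝ H] [CompleteSpace H] {A : H → Set H} (hA : IsMonotone A) {x a : H}
    (ha : a ∈ A x) {E : ℝ → ℕ → H} (hE0 : ∀ l, 0 ≤ l → E l 0 = x)
    (hE : ∀ l, 0 ≤ l → IsEulerSequence A l (E l)) :
    ∃ u : ℝ → H, ∀ t, 0 ≤ t → ∀ l, 0 ≤ l → ∀ i : ℕ,
      ‖E l i - u t‖ ^ 2 ≤ ‖a‖ ^ 2 * ((i * l - t) ^ 2 + i * l ^ 2) := by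
  have key : ∀ l, 0 ≤ l → ∀ m, 0 ≤ m → ∀ i j : ℕ,
      ‖E l i - E m j‖ ^ 2 ≤ ‖a‖ ^ 2 * ((i * l - j * m) ^ 2 + i * l ^ 2 + j * m ^ 2) :=
    fun l hl m hm => (hE l hl).norm_sub_sq_le (hE m hm) hA hl hm
      ((hE0 l hl).trans (hE0 m hm).symm) ((hE0 l hl).symm ▸ ha)
  have hlim : ∀ t, ∃ p : H, 0 ≤ t →
      Tendsto (fun n : ℕ => E (t / (n + 1 : ℕ)) (n + 1)) atTop (𝓝 p) := by
    intro t
    by_cases ht : 0 ≤ t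
    · have hc : CauchySeq fun n : ℕ => E (t / (n + 1 : ℕ)) (n + 1) := by
        refine cauchySeq_of_le_tendsto_0
          (fun N : ℕ => √(2 * ‖a‖ ^ 2 * t ^ 2 * (1 / ((N : ℝ) + 1)))) (fun n m N hn hm => ?_) ?_
        · have hle : ∀ k : ℕ, N ≤ k → t ^ 2 / ((k : ℝ) + 1) ≤ t ^ 2 * (1 / ((N : ℝ) + 1)) := by
            intro k hk
            rw [div_eq_mul_one_div]
            gcongr
          rw [dist_eq_norm]
          refine Real.le_sqrt_of_sq_le ?_
          refine (key _ (by positivity) _ (by positivity) _ _).trans ?_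
          push_cast
          have e1 : ((n : ℝ) + 1) * (t / (n + 1)) = t := by field_simp
          have e2 : ((m : ℝ) + 1) * (t / (m + 1)) = t := by field_simp
          have e3 : ((n : ℝ) + 1) * (t / (n + 1)) ^ 2 = t ^ 2 / (n + 1) := by field_simp
          have e4 : ((m : ℝ) + 1) * (t / (m + 1)) ^ 2 = t ^ 2 / (m + 1) := by field_simp
          rw [e1, e2, e3, e4]
          have := mul_le_mul_of_nonneg_left (add_le_add (hle n hn) (hle m hm)) (sq_nonneg ‖a‖)
          linarith
        · have h := (tendsto_one_div_add_atTop_nhds_zero_nat (𝕜 := ℝ)).const_mul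
            (2 * ‖a‖ ^ 2 * t ^ 2)
          simpa using h.sqrt
      obtain ⟨p, hp⟩ := cauchySeq_tendsto_of_complete hc
      exact ⟨p, fun _ => hp⟩
    · exact ⟨0, fun h => absurd h ht⟩
  choose u hu using hlim
  refine ⟨u, fun t ht l hl i => ?_⟩
  have h1 : Tendsto (fun n : ℕ => ‖E l i - E (t / (n + 1 : ℕ)) (n + 1)‖ ^ 2) atTop
      (𝓝 (‖E l i - u t‖ ^ 2)) := ((hu t ht).const_sub _).norm.pow 2
  have h2 : Tendsto (fun n : ℕ => ‖a‖ ^ 2 * ((i * l - t) ^ 2 + i * l ^ 2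
      + t ^ 2 * (1 / ((n : ℝ) + 1)))) atTop
      (𝓝 (‖a‖ ^ 2 * ((i * l - t) ^ 2 + i * l ^ 2 + t ^ 2 * 0))) :=
    ((tendsto_one_div_add_atTop_nhds_zero_nat.const_mul _).const_add _).const_mul _
  rw [mul_zero, add_zero] at h2
  refine le_of_tendsto_of_tendsto' h1 h2 fun n => ?_
  refine (key l hl (t / (n + 1 : ℕ)) (by positivity) i (n + 1)).trans_eq ?_
  push_cast
  have e1 : ((n : ℝ) + 1) * (t / (n + 1)) = t := by field_simp
  have e2 : ((n : ℝ) + 1) * (t / (n + 1)) ^ 2 = t ^ 2 * (1 / (n + 1)) := by field_simp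
  rw [e1, e2]

/-- A difference inequality that, wherever `u` is differentiable, turns the derivative into an
element of `-A u` by maximality. -/
theorem IsMaximalMonotone.neg_mem_of_hasDerivAt {H : Type*} [NormedAddCommGroup H]
    [InnerProductSpace ℝ H] {A : H → Set H} (hA : IsMaximalMonotone A) {u : ℝ → H} {t : ℝ}
    {v : H} (hv : HasDerivAt u v t)
    (h : ∀ y, ∀ w ∈ A y, ∃ C : ℝ, ∀ s, 0 < s →
      ‖u (t + s) - y‖ ^ 2 - ‖u t - y‖ ^ 2 ≤ -(2 * s * inner ℝ w (u t - y)) + C * s ^ 2) :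
    v ∈ -A (u t) := by
  rw [Set.mem_neg]
  refine hA.mem_of_forall_inner_nonneg fun y w hw => ?_
  obtain ⟨C, hC⟩ := h y w hw
  have hd : HasDerivAt (fun s => ‖u s - y‖ ^ 2) (2 * inner ℝ (u t - y) v) t :=
    (hv.sub_const y).norm_sq
  have hlim : Tendsto (fun s : ℝ => -(2 * inner ℝ w (u t - y)) + C * s) (𝓝[>] 0)
      (𝓝 (-(2 * inner ℝ w (u t - y)))) :=
    tendsto_nhdsWithin_of_tendsto_nhds (Continuous.tendsto' (by fun_prop) _ _ (by simp))
  have hle : 2 * inner ℝ (u t - y) v ≤ -(2 * inner ℝ w (u t - y)) := by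
    refine le_of_tendsto_of_tendsto hd.tendsto_slope_zero_right hlim
      (eventually_nhdsWithin_of_forall fun s hs => ?_)
    have hs : 0 < s := hs
    beta_reduce
    rw [smul_eq_mul, inv_mul_le_iff₀ hs]
    linarith [hC s hs]
  rw [inner_sub_left, inner_neg_left, real_inner_comm]
  linarith

/-- The inequality of `IsEulerSequence.norm_sub_sq_sub_le` passes to the limit. -/
theorem norm_sub_sq_sub_le_of_limit {H : Type*} [NormedAddCommGroup H]
    [InnerProductSpace ℝ H] {A : H → Set H} (hA : IsMonotone A) {x a : H}
    (ha : a ∈ A x) {E : ℝ → ℕ → H} (hE0 : ∀ l, 0 ≤ l → E l 0 = x)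
    (hE : ∀ l, 0 ≤ l → IsEulerSequence A l (E l)) {u : ℝ → H}
    (hu : ∀ t, 0 ≤ t → ∀ l, 0 ≤ l → ∀ i : ℕ,
      ‖E l i - u t‖ ^ 2 ≤ ‖a‖ ^ 2 * ((i * l - t) ^ 2 + i * l ^ 2))
    {t s : ℝ} (ht : 0 ≤ t) (hs : 0 < s) {y w : H} (hw : w ∈ A y) :
    ‖u (t + s) - y‖ ^ 2 - ‖u t - y‖ ^ 2
      ≤ -(2 * s * inner ℝ w (u t - y)) + 2 * ‖w‖ * ‖a‖ * s ^ 2 := by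
  -- With step `l k = s / k`, the time `s` takes `k` steps and the time `t` about `j k = t / l k`.
  set l : ℕ → ℝ := fun k => s / k with hl
  set j : ℕ → ℕ := fun k => ⌊t * (k / s)⌋₊ with hj
  have hl0 : ∀ k, 0 ≤ l k := fun k => by positivity
  have hlim_l : Tendsto l atTop (𝓝 0) := tendsto_const_div_atTop_nhds_zero_nat s
  have hlim_j : Tendsto (fun k => j k * l k) atTop (𝓝 t) := by
    have h := (tendsto_nat_floor_mul_div_atTop ht).comp
      (tendsto_natCast_atTop_atTop.atTop_div_const hs)
    refine h.congr fun k => ?_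
    simp only [hj, hl, Function.comp, div_eq_mul_inv, mul_inv, inv_inv]
    ring
  have hmul : ∀ k : ℕ, 1 ≤ k → k * l k = s := fun k hk => by
    have : (k : ℝ) ≠ 0 := by positivity
    simp only [hl]
    field_simp
  have hconv : ∀ (i : ℕ → ℕ) (r : ℝ), 0 ≤ r → Tendsto (fun k => i k * l k) atTop (𝓝 r) →
      Tendsto (fun k => E (l k) (i k)) atTop (𝓝 (u r)) := by
    intro i r hr hi
    rw [tendsto_iff_norm_sub_tendsto_zero]
    have h1 : Tendsto (fun k => ‖a‖ ^ 2 * ((i k * l k - r) ^ 2 + i k * l k * l k)) atTop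
        (𝓝 (‖a‖ ^ 2 * ((r - r) ^ 2 + r * 0))) :=
      (((hi.sub_const r).pow 2).add (hi.mul hlim_l)).const_mul _
    have h2 : Tendsto (fun k => ‖E (l k) (i k) - u r‖ ^ 2) atTop (𝓝 0) := by
      refine squeeze_zero (fun k => sq_nonneg _) (fun k => ?_) (by simpa using h1)
      exact (hu r hr (l k) (hl0 k) (i k)).trans_eq (by ring)
    simpa using h2.sqrt
  have hEt := hconv j t ht hlim_j
  have hEts := hconv (fun k => j k + k) (t + s) (by positivity) (by
    refine (hlim_j.add_const s).congr' ?_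
    filter_upwards [eventually_ge_atTop 1] with k hk
    rw [← hmul k hk]
    push_cast
    ring)
  have hleft := (((hEts.sub_const y).norm.pow 2).sub ((hEt.sub_const y).norm.pow 2))
  have hright : Tendsto (fun k => -(2 * s * inner ℝ w (E (l k) (j k) - y))
      + 2 * ‖w‖ * ‖a‖ * s ^ 2) atTop
      (𝓝 (-(2 * s * inner ℝ w (u t - y)) + 2 * ‖w‖ * ‖a‖ * s ^ 2)) :=
    ((((tendsto_const_nhds.inner (hEt.sub_const y)).const_mul _).neg).add_const _)
  refine le_of_tendsto_of_tendsto hleft hright ?_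
  filter_upwards [eventually_ge_atTop 1] with k hk
  have h := (hE (l k) (hl0 k)).norm_sub_sq_sub_le hA (hl0 k)
    ((hE0 (l k) (hl0 k)).symm ▸ ha) hw (j k) k
  rwa [hmul k hk] at h

end SetOperator

theorem mainTheorem3 {H : Type*} [NormedAddCommGroup H] [InnerProductSpace ℝ H] [CompleteSpace H]
    (A : H → Set H) (hA : SetOperator.IsMaximalMonotone A) (x : H) (hx : x ∈ SetOperator.dom A) :
    ∃ (um : ℕ → ℝ → H) (u : ℝ → H) (a : H),
      (∀ m : ℕ, 1 ≤ m → ∀ t : ℝ, 0 ≤ t →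
        SetOperator.power (SetOperator.resolvent A (t / (m : ℝ))) m x = {um m t}) ∧
      (∀ T : ℝ, 0 ≤ T → TendstoUniformlyOn um u atTop (Icc 0 T)) ∧
      SetOperator.minimalSection A x = {a} ∧
      LipschitzOnWith ‖a‖₊ u (Ici 0) ∧
      SetOperator.IsSolution A x u := by
  obtain ⟨a, hmin⟩ := hA.exists_minimalSection_eq_singleton hx
  have ha : a ∈ A x := (hmin.symm ▸ mem_singleton a : a ∈ SetOperator.minimalSection A x).1
  have hex : ∀ l : ℝ, ∃ X : ℕ → H, 0 ≤ l → X 0 = x ∧ SetOperator.IsEulerSequence A l X := by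
    intro l
    by_cases hl : 0 ≤ l
    · obtain ⟨X, hX⟩ := hA.exists_isEulerSequence hl hx
      exact ⟨X, fun _ => hX⟩
    · exact ⟨0, fun h => absurd h hl⟩
  choose E hE' using hex
  have hE0 : ∀ l, 0 ≤ l → E l 0 = x := fun l hl => (hE' l hl).1
  have hE : ∀ l, 0 ≤ l → SetOperator.IsEulerSequence A l (E l) := fun l hl => (hE' l hl).2
  obtain ⟨u, hu⟩ := SetOperator.exists_limit_of_isEulerSequence hA.1 ha hE0 hE
  -- The error bound along the sequence `u_m`.
  have hum : ∀ s, 0 ≤ s → ∀ t, 0 ≤ t → ∀ m : ℕ, 1 ≤ m →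
      ‖E (t / m) m - u s‖ ^ 2 ≤ ‖a‖ ^ 2 * ((t - s) ^ 2 + t ^ 2 / m) := by
    intro s hs t ht m hm
    have hm' : (m : ℝ) ≠ 0 := by positivity
    refine (hu s hs (t / m) (by positivity) m).trans_eq ?_
    have e1 : (m : ℝ) * (t / m) = t := by field_simp
    have e2 : (m : ℝ) * (t / m) ^ 2 = t ^ 2 / m := by field_simp
    rw [e1, e2]
  have hunif : ∀ T : ℝ, 0 ≤ T →
      TendstoUniformlyOn (fun (m : ℕ) t => E (t / m) m) u atTop (Icc 0 T) := by
    intro T hT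
    rw [Metric.tendstoUniformlyOn_iff]
    intro ε hε
    have hlim : Tendsto (fun m : ℕ => ‖a‖ ^ 2 * T ^ 2 / (m : ℝ)) atTop (𝓝 0) :=
      tendsto_const_div_atTop_nhds_zero_nat _
    filter_upwards [hlim.eventually_lt_const (show 0 < ε ^ 2 by positivity),
      eventually_ge_atTop 1] with m hmε hm t ht
    rw [dist_comm, dist_eq_norm]
    refine lt_of_pow_lt_pow_left₀ 2 hε.le (lt_of_le_of_lt ?_ hmε)
    refine (hum t ht.1 t ht.1 m hm).trans ?_
    rw [sub_self, zero_pow two_ne_zero, zero_add, mul_div_assoc]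
    have := ht.1
    have := ht.2
    gcongr
  have hlip : LipschitzOnWith ‖a‖₊ u (Ici 0) := by
    refine LipschitzOnWith.of_dist_le_mul fun t ht s hs => ?_
    have h1 : Tendsto (fun m : ℕ => ‖E (t / m) m - u s‖ ^ 2) atTop (𝓝 (‖u t - u s‖ ^ 2)) :=
      ((((hunif t ht).tendsto_at ⟨ht, le_rfl⟩).sub_const _).norm.pow 2)
    have h2 : Tendsto (fun m : ℕ => ‖a‖ ^ 2 * ((t - s) ^ 2 + t ^ 2 / (m : ℝ))) atTop
        (𝓝 (‖a‖ ^ 2 * ((t - s) ^ 2 + 0))) :=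
      ((tendsto_const_div_atTop_nhds_zero_nat _).const_add _).const_mul _
    have h3 : ‖u t - u s‖ ^ 2 ≤ ‖a‖ ^ 2 * ((t - s) ^ 2 + 0) :=
      le_of_tendsto_of_tendsto h1 h2 (by
        filter_upwards [eventually_ge_atTop 1] with m hm using hum s hs t ht m hm)
    rw [add_zero, ← sq_abs (t - s), ← mul_pow] at h3
    rw [dist_eq_norm, Real.dist_eq]
    exact (sq_le_sq₀ (norm_nonneg _) (by positivity)).1 h3
  refine ⟨fun m t => E (t / m) m, u, a, fun m _ t ht => ?_, hunif, hmin, hlip, ?_, ?_, ?_, hx⟩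
  · have hl : (0 : ℝ) ≤ t / m := by positivity
    have h := (hE _ hl).power_resolvent_eq hA.1 hl m
    rwa [hE0 _ hl] at h
  · intro T hT
    refine (hlip.mono fun t ht => ?_).absolutelyContinuousOnInterval
    rw [uIcc_of_le hT] at ht
    exact ht.1
  · -- Extend `u` by its value at `0` to a Lipschitz curve on the whole line.
    have hext : LipschitzWith ‖a‖₊ fun t => u (max t 0) := by
      refine LipschitzWith.of_dist_le_mul fun t s => ?_
      refine (hlip.dist_le_mul _ (le_max_right t 0) _ (le_max_right s 0)).trans ?_
      gcongr
      simpa [Real.dist_eq] using abs_max_sub_max_le_abs t s 0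
    filter_upwards [ae_restrict_of_ae hext.ae_differentiableAt_of_hilbert,
      ae_restrict_mem measurableSet_Ioi] with t hdiff ht
    have heq : u =ᶠ[𝓝 t] fun s => u (max s 0) := by
      filter_upwards [Ioi_mem_nhds ht] with s hs
      rw [max_eq_left (le_of_lt hs)]
    have hderiv := (hdiff.congr_of_eventuallyEq heq).hasDerivAt
    exact ⟨_, hderiv, hA.neg_mem_of_hasDerivAt hderiv fun y w hw => ⟨2 * ‖w‖ * ‖a‖, fun s hs =>
      SetOperator.norm_sub_sq_sub_le_of_limit hA.1 ha hE0 hE hu (le_of_lt ht) hs hw⟩⟩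
  · have h := hu 0 le_rfl 0 le_rfl 0
    rw [hE0 0 le_rfl] at h
    have h0 : ‖x - u 0‖ ^ 2 ≤ 0 := by simpa using h
    have h1 : ‖x - u 0‖ = 0 := pow_eq_zero_iff two_ne_zero |>.1 (le_antisymm h0 (sq_nonneg _))
    exact (sub_eq_zero.1 (norm_eq_zero.1 h1)).symm
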